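/- A finite generalized quadrangle of order $(s,t)$, with integers $s,t\ge 1$, consists of finite non-empty sets $\mathcal P$ of points and $\mathcal L$ of lines and an incidence relation $\mathrm I$ between them such that: each point is incident with exactly $t+1$ lines, and two distinct points are incident with at most one common line; each line is incident with exactly $s+1$ points, and two distinct lines are incident with at most one common point; and for every point $p$ and every line $L$ not incident with $p$ there is a unique pair $(q,M)\in\mathcal P\times\mathcal L$ with $p\,\mathrm I\,M\,\mathrm I\,q\,\mathrm I\,L$. Distinct points $p,q$ are collinear (on $L$) if both are incident with some line $L$. A flag is a pair $(p,L)\in\mathcal P\times\mathcal L$ with $p\,\mathrm I\,L$; let $\Omega$ be the set of flags. On $\Omega$ let $R_0$ be the diagonal, and let $((p,L),(q,M))$ belong to - $R_1$ iff $p=q$ and $L\ne M$; - $R_2$ iff $L=M$ and $p\neq q$; - $R_3$ iff $L\ne M$, and $p\neq q$ are collinear on $L$; - $R_4$ iff $L\ne M$, and $p\neq q$ are collinear on $M$; - $R_5$ iff $p\ne q$ are collinear, but neither on $L$ nor on $M$; - $R_6$ iff $L\neq M$, and $L$ and $M$ intersect at a point $r$ with $r\neq p$ and $r\ne q$; - $R_7$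 iff no point is incident with both $L$ and $M$, and $p,q$ are not collinear. An association scheme on a finite set $X$ is a partition of $X\times X$ into non-empty relations $R_i$ $(i\in I)$, one of which is the diagonal $R_0$, closed under taking the converse relation, and such that for all $i,j,k\in I$ there is a constant $p_{ij}^k$ (an intersection number) with $|\{z:(x,z)\in R_i,\ (z,y)\in R_j\}|=p_{ij}^k$ for every $(x,y)\in R_k$. Its order is $|X|$ and its class is $|I\setminus\{0\}|$; it is commutative if $p_{ij}^k=p_{ji}^k$ for all $i,j,k$. A parabolic is a union of relations $R_i$ that is an equivalence relation on $X$; it is trivial if it is $R_0$ or $X\times X$. The scheme is imprimitive if it has a non-trivial parabolic. **Theorem.** For every finite generalized quadrangle of order $(s,t)$ with $s,t\ge1$, the pair $(\Omega,\{R_0,\dots,R_7\})$ is an association scheme of order $(s+1)(t+1)(st+1)$ and class $7$. It is noncommutative and imprimitive, and $R_0\cup R_1$ and $R_0\cup R_2$ are non-trivial parabolics. Its intersection numbers are the following polynomials in $s$ and $t$ (with $i,j\in\{0,\dots,7\}$). For $k=0$, $p_{ij}^0=0$ unless $(i,j)\in\{(0,0),(1,1),(2,2),(3,4),(4,3),(5,5),(6,6),(7,7)\}$,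 and \[ p_{00}^0=1,\quad p_{11}^0=t,\quad p_{22}^0=s,\quad p_{34}^0=p_{43}^0=st,\quad p_{55}^0=st^2,\quad p_{66}^0=s^2t,\quad p_{77}^0=(st)^2 . \] For $k=1,\dots,7$, $p_{ij}^k$ is the $(i,j)$-entry (rows and columns numbered from $0$ to $7$) of the matrix $L_k$, where \[ L_1=\begin{pmatrix} 0 & 1 & 0 & 0 & 0 & 0 & 0 & 0 \\ 1 & t-1 & 0 & 0 & 0 & 0 & 0 & 0 \\ 0 & 0 & 0 & s & 0 & 0 & 0 & 0 \\ 0 & 0 & 0 & 0 & 0 & st & 0 & 0 \\ 0 & 0 & s & s(t-1) & 0 & 0 & 0 & 0 \\ 0 & 0 & 0 & 0 & st & st(t-1) & 0 & 0 \\ 0 & 0 & 0 & 0 & 0 & 0 & 0 & s^2t \\ 0 & 0 & 0 & 0 & 0 & 0 & s^2t & s^2t(t-1) \end{pmatrix} \] \[ L_2=\begin{pmatrix} 0 & 0 & 1 & 0 & 0 & 0 & 0 & 0 \\ 0 & 0 & 0 & 0 & t & 0 & 0 & 0 \\ 1 & 0 & s-1 & 0 & 0 & 0 & 0 & 0 \\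 0 & t & 0 & 0 & t(s-1) & 0 & 0 & 0 \\ 0 & 0 & 0 & 0 & 0 & 0 & st & 0 \\ 0 & 0 & 0 & 0 & 0 & 0 & 0 & st^2 \\ 0 & 0 & 0 & st & 0 & 0 & st(s-1) & 0 \\ 0 & 0 & 0 & 0 & 0 & st^2 & 0 & st^2(s-1) \end{pmatrix} \] \[ L_3=\begin{pmatrix} 0 & 0 & 0 & 1 & 0 & 0 & 0 & 0 \\ 0 & 0 & 0 & 0 & 0 & t & 0 & 0 \\ 0 & 1 & 0 & s-1 & 0 & 0 & 0 & 0 \\ 1 & t-1 & 0 & 0 & 0 & t(s-1) & 0 & 0 \\ 0 & 0 & 0 & 0 & 0 & 0 & 0 & st \\ 0 & 0 & 0 & 0 & 0 & 0 & st & st(t-1) \\ 0 & 0 & s & s(t-1) & 0 & 0 & 0 & st(s-1) \\ 0 & 0 & 0 & 0 & st & st(t-1) & st(s-1) & st(s-1)(t-1) \end{pmatrix} \] \[ L_4=\begin{pmatrix} 0 & 0 & 0 & 0 & 1 & 0 & 0 & 0 \\ 0 & 0 & 1 & 0 & t-1 & 0 & 0 & 0 \\ 0 & 0 & 0 & 0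 & 0 & 0 & s & 0 \\ 0 & 0 & 0 & 0 & 0 & 0 & 0 & st \\ 1 & 0 & s-1 & 0 & 0 & 0 & s(t-1) & 0 \\ 0 & t & 0 & 0 & t(s-1) & 0 & 0 & st(t-1) \\ 0 & 0 & 0 & 0 & 0 & st & 0 & st(s-1) \\ 0 & 0 & 0 & st & 0 & st(t-1) & st(s-1) & st(s-1)(t-1) \end{pmatrix} \] \[ L_5=\begin{pmatrix} 0 & 0 & 0 & 0 & 0 & 1 & 0 & 0 \\ 0 & 0 & 0 & 1 & 0 & t-1 & 0 & 0 \\ 0 & 0 & 0 & 0 & 0 & 0 & 0 & s \\ 0 & 0 & 0 & 0 & 0 & 0 & s & s(t-1) \\ 0 & 1 & 0 & s-1 & 0 & 0 & 0 & s(t-1) \\ 1 & t-1 & 0 & 0 & 0 & t(s-1) & s(t-1) & s(t-1)^2 \\ 0 & 0 & 0 & 0 & s & s(t-1) & s(s-1) & s(s-1)(t-1) \\ 0 & 0 & s & s(t-1) & s(t-1) & s(t-1)^2 & s(s-1)(t-1) & s(s-1)(t^2-t+1) \end{pmatrix} \] \[ L_6=\begin{pmatrix} 0 & 0 & 0 &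 0 & 0 & 0 & 1 & 0 \\ 0 & 0 & 0 & 0 & 0 & 0 & 0 & t \\ 0 & 0 & 0 & 0 & 1 & 0 & s-1 & 0 \\ 0 & 0 & 1 & 0 & t-1 & 0 & 0 & t(s-1) \\ 0 & 0 & 0 & 0 & 0 & t & 0 & t(s-1) \\ 0 & 0 & 0 & t & 0 & t(t-1) & t(s-1) & t(s-1)(t-1) \\ 1 & 0 & s-1 & 0 & 0 & t(s-1) & s(t-1) & t(s-1)^2 \\ 0 & t & 0 & t(s-1) & t(s-1) & t(s-1)(t-1) & t(s-1)^2 & t(t-1)(s^2-s+1) \end{pmatrix} \] \[ L_7=\begin{pmatrix} 0 & 0 & 0 & 0 & 0 & 0 & 0 & 1 \\ 0 & 0 & 0 & 0 & 0 & 0 & 1 & t-1 \\ 0 & 0 & 0 & 0 & 0 & 1 & 0 & s-1 \\ 0 & 0 & 0 & 1 & 0 & t-1 & s-1 & (s-1)(t-1) \\ 0 & 0 & 0 & 0 & 1 & t-1 & s-1 & (s-1)(t-1) \\ 0 & 0 & 1 & t-1 & t-1 & (t-1)^2 & (s-1)(t-1) & (s-1)(t^2-t+1) \\ 0 & 1 &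 0 & s-1 & s-1 & (s-1)(t-1) & (s-1)^2 & (s^2-s+1)(t-1) \\ 1 & t-1 & s-1 & (s-1)(t-1) & (s-1)(t-1) & (s-1)(t^2-t+1) & (s^2-s+1)(t-1) & 1-s+s^2-t-s^2t+t^2-st^2+s^2t^2 \end{pmatrix} \] -/

import Mathlib

/-! Association schemes (not necessarily symmetric or commutative). -/

/-- An association scheme on `X` whose basis relations are indexed by `I`.  The fields `finite`,
`rel_nonempty` and `partition` say that the `rel i` are pairwise distinct and are the classes of a
partition of the finite set `X × X`. -/
structure AssociationScheme (X : Type*) (I : Type*) where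
  /-- the basis relation `R i` -/
  rel : I → Set (X × X)
  /-- the index of the diagonal relation -/
  zero : I
  /-- `p i j k` is the intersection number `p_{ij}^k` -/
  p : I → I → I → ℕ
  finite : Finite X
  rel_nonempty : ∀ i, (rel i).Nonempty
  partition : ∀ a : X × X, ∃! i, a ∈ rel i
  rel_zero : rel zero = {a | a.1 = a.2}
  rel_symm : ∀ i, ∃ j, rel j = {a | (a.2, a.1) ∈ rel i}
  card_eq : ∀ i j k x y, (x, y) ∈ rel k →
    Set.ncard {z | (x, z) ∈ rel i ∧ (z, y) ∈ rel j} = p i j k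

namespace AssociationScheme

variable {X I : Type*} (S : AssociationScheme X I)

/-- The order of a scheme: the number of elements of the underlying set. -/
noncomputable def order (_ : AssociationScheme X I) : ℕ := Nat.card X

/-- The class of a scheme: the number of basis relations other than the diagonal. -/
noncomputable def classNumber : ℕ := Nat.card {i : I // i ≠ S.zero}

/-- `p_{ij}^k = p_{ji}^k` for all `i, j, k`. -/
def IsCommutative : Prop := ∀ i j k, S.p i j k = S.p j i k

/-- A parabolic: a union of basis relations that is an equivalence relation. -/
def IsParabolic (e : Set (X × X)) : Prop :=
  (∃ J : Set I, e = ⋃ i ∈ J, S.rel i) ∧ Equivalence (fun x y => (x, y) ∈ e)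

/-- The trivial parabolics: the diagonal and `X × X`. -/
def IsTrivialParabolic (e : Set (X × X)) : Prop := e = S.rel S.zero ∨ e = Set.univ

/-- A scheme is primitive if its only parabolics are the trivial ones. -/
def IsPrimitive : Prop := ∀ e, S.IsParabolic e → S.IsTrivialParabolic e

/-- A scheme is imprimitive if it is not primitive. -/
def IsImprimitive : Prop := ¬ S.IsPrimitive

end AssociationScheme

/-! Generalized quadrangles and their flags. -/

/-- The incidence structure with point set `P`, line set `L` and incidence `Inc` is a generalized
quadrangle of order `(s, t)`. -/
structure IsGeneralizedQuadrangle {P L : Type*} (Inc : P → L → Prop) (s t : ℕ) : Prop where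
  nonempty_points : Nonempty P
  nonempty_lines : Nonempty L
  card_lines : ∀ p : P, Set.ncard {l | Inc p l} = t + 1
  line_unique : ∀ (p q : P) (l m : L), p ≠ q → Inc p l → Inc q l → Inc p m → Inc q m → l = m
  card_points : ∀ l : L, Set.ncard {p | Inc p l} = s + 1
  point_unique : ∀ (l m : L) (p q : P), l ≠ m → Inc p l → Inc p m → Inc q l → Inc q m → p = q
  projection : ∀ (p : P) (l : L), ¬ Inc p l →
    ∃! qm : P × L, Inc p qm.2 ∧ Inc qm.1 qm.2 ∧ Inc qm.1 l

section Flags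

variable {P L : Type*} (Inc : P → L → Prop)

/-- A flag: an incident point-line pair. -/
def GQFlag : Type _ := {x : P × L // Inc x.1 x.2}

/-- The point of a flag. -/
def GQFlag.point {Inc : P → L → Prop} (x : GQFlag Inc) : P := x.1.1

/-- The line of a flag. -/
def GQFlag.line {Inc : P → L → Prop} (x : GQFlag Inc) : L := x.1.2

/-- `p` and `q` are (distinct and) collinear on `l`. -/
def CollinearOn (p q : P) (l : L) : Prop := p ≠ q ∧ Inc p l ∧ Inc q l

/-- `p` and `q` are (distinct and) collinear. -/
def ArePointsCollinear (p q : P) : Prop := ∃ l, CollinearOn Inc p q l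

/-- The distinct lines `l` and `m` intersect at the point `r`. -/
def IntersectAt (l m : L) (r : P) : Prop := l ≠ m ∧ Inc r l ∧ Inc r m

/-- The relations `R_0, …, R_7` on the flags. -/
def flagRel : Fin 8 → Set (GQFlag Inc × GQFlag Inc)
  | 0 => {a | a.1 = a.2}
  | 1 => {a | a.1.point = a.2.point ∧ a.1.line ≠ a.2.line}
  | 2 => {a | a.1.line = a.2.line ∧ a.1.point ≠ a.2.point}
  | 3 => {a | CollinearOn Inc a.1.point a.2.point a.1.line ∧ a.1.line ≠ a.2.line}
  | 4 => {a | CollinearOn Inc a.1.point a.2.point a.2.line ∧ a.1.line ≠ a.2.line}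
  | 5 => {a | ArePointsCollinear Inc a.1.point a.2.point ∧
      ¬ CollinearOn Inc a.1.point a.2.point a.1.line ∧
      ¬ CollinearOn Inc a.1.point a.2.point a.2.line}
  | 6 => {a | ∃ r, IntersectAt Inc a.1.line a.2.line r ∧ r ≠ a.1.point ∧ r ≠ a.2.point}
  | 7 => {a | (¬ ∃ r, Inc r a.1.line ∧ Inc r a.2.line) ∧
      ¬ ArePointsCollinear Inc a.1.point a.2.point}

end Flags

/-- The matrices `L_0, …, L_7`; the `(i, j)` entry of `L_k` is the polynomial giving `p_{ij}^k`.
(The non-zero entries of `L_0` are the valencies.) -/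
def flagMatrix (s t : ℤ) : Fin 8 → Matrix (Fin 8) (Fin 8) ℤ
  | 0 => !![
      1, 0, 0, 0, 0, 0, 0, 0;
      0, t, 0, 0, 0, 0, 0, 0;
      0, 0, s, 0, 0, 0, 0, 0;
      0, 0, 0, 0, s*t, 0, 0, 0;
      0, 0, 0, s*t, 0, 0, 0, 0;
      0, 0, 0, 0, 0, s*t^2, 0, 0;
      0, 0, 0, 0, 0, 0, s^2*t, 0;
      0, 0, 0, 0, 0, 0, 0, (s*t)^2]
  | 1 => !![
      0, 1, 0, 0, 0, 0, 0, 0;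
      1, t-1, 0, 0, 0, 0, 0, 0;
      0, 0, 0, s, 0, 0, 0, 0;
      0, 0, 0, 0, 0, s*t, 0, 0;
      0, 0, s, s*(t-1), 0, 0, 0, 0;
      0, 0, 0, 0, s*t, s*t*(t-1), 0, 0;
      0, 0, 0, 0, 0, 0, 0, s^2*t;
      0, 0, 0, 0, 0, 0, s^2*t, s^2*t*(t-1)]
  | 2 => !![
      0, 0, 1, 0, 0, 0, 0, 0;
      0, 0, 0, 0, t, 0, 0, 0;
      1, 0, s-1, 0, 0, 0, 0, 0;
      0, t, 0, 0, t*(s-1), 0, 0, 0;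
      0, 0, 0, 0, 0, 0, s*t, 0;
      0, 0, 0, 0, 0, 0, 0, s*t^2;
      0, 0, 0, s*t, 0, 0, s*t*(s-1), 0;
      0, 0, 0, 0, 0, s*t^2, 0, s*t^2*(s-1)]
  | 3 => !![
      0, 0, 0, 1, 0, 0, 0, 0;
      0, 0, 0, 0, 0, t, 0, 0;
      0, 1, 0, s-1, 0, 0, 0, 0;
      1, t-1, 0, 0, 0, t*(s-1), 0, 0;
      0, 0, 0, 0, 0, 0, 0, s*t;
      0, 0, 0, 0, 0, 0, s*t, s*t*(t-1);
      0, 0, s, s*(t-1), 0, 0, 0, s*t*(s-1);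
      0, 0, 0, 0, s*t, s*t*(t-1), s*t*(s-1), s*t*(s-1)*(t-1)]
  | 4 => !![
      0, 0, 0, 0, 1, 0, 0, 0;
      0, 0, 1, 0, t-1, 0, 0, 0;
      0, 0, 0, 0, 0, 0, s, 0;
      0, 0, 0, 0, 0, 0, 0, s*t;
      1, 0, s-1, 0, 0, 0, s*(t-1), 0;
      0, t, 0, 0, t*(s-1), 0, 0, s*t*(t-1);
      0, 0, 0, 0, 0, s*t, 0, s*t*(s-1);
      0, 0, 0, s*t, 0, s*t*(t-1), s*t*(s-1), s*t*(s-1)*(t-1)]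
  | 5 => !![
      0, 0, 0, 0, 0, 1, 0, 0;
      0, 0, 0, 1, 0, t-1, 0, 0;
      0, 0, 0, 0, 0, 0, 0, s;
      0, 0, 0, 0, 0, 0, s, s*(t-1);
      0, 1, 0, s-1, 0, 0, 0, s*(t-1);
      1, t-1, 0, 0, 0, t*(s-1), s*(t-1), s*(t-1)^2;
      0, 0, 0, 0, s, s*(t-1), s*(s-1), s*(s-1)*(t-1);
      0, 0, s, s*(t-1), s*(t-1), s*(t-1)^2, s*(s-1)*(t-1), s*(s-1)*(t^2-t+1)]
  | 6 => !![
      0, 0, 0, 0, 0, 0, 1, 0;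
      0, 0, 0, 0, 0, 0, 0, t;
      0, 0, 0, 0, 1, 0, s-1, 0;
      0, 0, 1, 0, t-1, 0, 0, t*(s-1);
      0, 0, 0, 0, 0, t, 0, t*(s-1);
      0, 0, 0, t, 0, t*(t-1), t*(s-1), t*(s-1)*(t-1);
      1, 0, s-1, 0, 0, t*(s-1), s*(t-1), t*(s-1)^2;
      0, t, 0, t*(s-1), t*(s-1), t*(s-1)*(t-1), t*(s-1)^2, t*(t-1)*(s^2-s+1)]
  | 7 => !![
      0, 0, 0, 0, 0, 0, 0, 1;
      0, 0, 0, 0, 0, 0, 1, t-1;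
      0, 0, 0, 0, 0, 1, 0, s-1;
      0, 0, 0, 1, 0, t-1, s-1, (s-1)*(t-1);
      0, 0, 0, 0, 1, t-1, s-1, (s-1)*(t-1);
      0, 0, 1, t-1, t-1, (t-1)^2, (s-1)*(t-1), (s-1)*(t^2-t+1);
      0, 1, 0, s-1, s-1, (s-1)*(t-1), (s-1)^2, (s^2-s+1)*(t-1);
      1, t-1, s-1, (s-1)*(t-1), (s-1)*(t-1), (s-1)*(t^2-t+1), (s^2-s+1)*(t-1),
        1 - s + s^2 - t - s^2*t + t^2 - s*t^2 + s^2*t^2]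

/-!
The eight relations on flags are indexed by the dihedral group of order 8: `R_1` changes the line
of a flag, `R_2` changes its point, and two flags are in `R_3, …, R_7` when the shortest chain of
alternating changes from one to the other has the type `21`, `12`, `121`, `212`, `1212 = 2121`.
So the `R_i` should multiply as the standard basis of the Iwahori–Hecke algebra of that group with
parameters `t` and `s`.

Concretely, let `A i` be the adjacency matrix of `R_i`. Counting lines on a point and points on a
line gives the quadratic relations `A 1 ^ 2 = t + (t - 1) A 1` and `A 2 ^ 2 = s + (s - 1) A 2`.
The middle flag of a shortest chain is unique (`flagAdj_mul_of_existsUnique`), which gives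
`A 2 A 1 = A 3`, `A 1 A 2 = A 4`, `A 1 A 3 = A 5`, `A 2 A 4 = A 6` and `A 1 A 6 = A 7 = A 2 A 5`;
the two formulas for `A 7` rest on the projection axiom of the quadrangle, as does the disjointness
of `R_6` from `R_5`. These identities determine
left multiplication by `A 1` and `A 2` on the span of the `A i`, and since every `A i` is a product
of `A 1`s and `A 2`s, all products `A i A j` follow by multiplying coefficient tables
(`flagAdj_mul`). An entry of `A i A j` is the number of middle flags, so these coefficients
are the intersection numbers. The number of flags is the diagonal entry of the square of the
all-ones matrix `∑ i, A i`, hence is a sum of intersection numbers too.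
-/

section FlagScheme

variable {P L : Type*} {Inc : P → L → Prop} {s t : ℕ}

/-! ### Flags and their relations -/

theorem GQFlag.inc (x : GQFlag Inc) : Inc x.point x.line := x.2

theorem GQFlag.ext {x y : GQFlag Inc} (hp : x.point = y.point) (hl : x.line = y.line) : x = y :=
  Subtype.ext (Prod.ext hp hl)

/-- The flag consisting of the incident pair `(p, l)`. -/
def GQFlag.mk {p : P} {l : L} (h : Inc p l) : GQFlag Inc := ⟨(p, l), h⟩

theorem GQFlag.finite [Finite P] [Finite L] : Finite (GQFlag Inc) :=
  inferInstanceAs (Finite {x : P × L // Inc x.1 x.2})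

theorem mem_flagRel_zero {x y : GQFlag Inc} : (x, y) ∈ flagRel Inc 0 ↔ x = y := Iff.rfl

theorem mem_flagRel_one {x y : GQFlag Inc} :
    (x, y) ∈ flagRel Inc 1 ↔ x.point = y.point ∧ x.line ≠ y.line := Iff.rfl

theorem mem_flagRel_two {x y : GQFlag Inc} :
    (x, y) ∈ flagRel Inc 2 ↔ x.line = y.line ∧ x.point ≠ y.point := Iff.rfl

theorem mem_flagRel_three {x y : GQFlag Inc} :
    (x, y) ∈ flagRel Inc 3 ↔ x.point ≠ y.point ∧ Inc y.point x.line ∧ x.line ≠ y.line := by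
  have := x.inc
  simp only [flagRel, CollinearOn, Set.mem_ofPred_eq]
  tauto

theorem mem_flagRel_four {x y : GQFlag Inc} :
    (x, y) ∈ flagRel Inc 4 ↔ x.point ≠ y.point ∧ Inc x.point y.line ∧ x.line ≠ y.line := by
  have := y.inc
  simp only [flagRel, CollinearOn, Set.mem_ofPred_eq]
  tauto

theorem mem_flagRel_five {x y : GQFlag Inc} :
    (x, y) ∈ flagRel Inc 5 ↔ (∃ l, Inc x.point l ∧ Inc y.point l) ∧ x.point ≠ y.point ∧
      ¬ Inc y.point x.line ∧ ¬ Inc x.point y.line := by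
  have := x.inc
  have := y.inc
  simp only [flagRel, CollinearOn, ArePointsCollinear, Set.mem_ofPred_eq, exists_and_left]
  tauto

theorem mem_flagRel_six {x y : GQFlag Inc} :
    (x, y) ∈ flagRel Inc 6 ↔ ∃ r, (x.line ≠ y.line ∧ Inc r x.line ∧ Inc r y.line) ∧
      r ≠ x.point ∧ r ≠ y.point := Iff.rfl

theorem mem_flagRel_seven {x y : GQFlag Inc} :
    (x, y) ∈ flagRel Inc 7 ↔ (¬ ∃ r, Inc r x.line ∧ Inc r y.line) ∧
      ¬ ∃ l, x.point ≠ y.point ∧ Inc x.point l ∧ Inc y.point l := Iff.rfl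

theorem exists_mem_flagRel (x y : GQFlag Inc) : ∃ i, (x, y) ∈ flagRel Inc i := by
  have hx := x.inc
  have hy := y.inc
  by_cases hp : x.point = y.point
  · by_cases hl : x.line = y.line
    · exact ⟨0, GQFlag.ext hp hl⟩
    · exact ⟨1, hp, hl⟩
  by_cases hl : x.line = y.line
  · exact ⟨2, hl, hp⟩
  by_cases h3 : Inc y.point x.line
  · exact ⟨3, mem_flagRel_three.2 ⟨hp, h3, hl⟩⟩
  by_cases h4 : Inc x.point y.line
  · exact ⟨4, mem_flagRel_four.2 ⟨hp, h4, hl⟩⟩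
  by_cases h5 : ∃ l, Inc x.point l ∧ Inc y.point l
  · exact ⟨5, mem_flagRel_five.2 ⟨h5, hp, h3, h4⟩⟩
  by_cases h6 : ∃ r, Inc r x.line ∧ Inc r y.line
  · obtain ⟨r, hr⟩ := h6
    refine ⟨6, r, ⟨hl, hr⟩, ?_, ?_⟩ <;> rintro rfl <;> tauto
  · refine ⟨7, h6, ?_⟩
    rintro ⟨l, -, h⟩
    exact h5 ⟨l, h⟩

theorem IsGeneralizedQuadrangle.exists_projection (h : IsGeneralizedQuadrangle Inc s t)
    {p : P} {l : L} (hpl : ¬ Inc p l) : ∃ q m, Inc p m ∧ Inc q m ∧ Inc q l := by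
  obtain ⟨⟨q, m⟩, hqm, -⟩ := h.projection p l hpl
  exact ⟨q, m, hqm⟩

theorem IsGeneralizedQuadrangle.projection_unique (h : IsGeneralizedQuadrangle Inc s t)
    {p q q' : P} {l m m' : L} (hpl : ¬ Inc p l) (hm : Inc p m ∧ Inc q m ∧ Inc q l)
    (hm' : Inc p m' ∧ Inc q' m' ∧ Inc q' l) : q = q' ∧ m = m' :=
  Prod.ext_iff.1 ((h.projection p l hpl).unique (y₁ := (q, m)) (y₂ := (q', m')) hm hm')

theorem incidences_of_mem_flagRel_six (h : IsGeneralizedQuadrangle Inc s t) {x y : GQFlag Inc}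
    (hxy : (x, y) ∈ flagRel Inc 6) :
    (x.line ≠ y.line ∧ x.point ≠ y.point ∧ ¬ Inc y.point x.line ∧ ¬ Inc x.point y.line) ∧
      (¬ ∃ l, Inc x.point l ∧ Inc y.point l) ∧ ∃ r, Inc r x.line ∧ Inc r y.line := by
  have hx := x.inc
  have hy := y.inc
  obtain ⟨r, ⟨hl, hrx, hry⟩, hrp, hrq⟩ := hxy
  have h3 : ¬ Inc y.point x.line := fun h' => hrq (h.point_unique _ _ _ _ hl hrx hry h' hy)
  have h4 : ¬ Inc x.point y.line := fun h' => hrp (h.point_unique _ _ _ _ hl hrx hry hx h')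
  refine ⟨⟨hl, fun e => h3 (e ▸ hx), h3, h4⟩, ?_, r, hrx, hry⟩
  rintro ⟨l, hpl, hql⟩
  -- both `(r, x.line)` and `(y.point, l)` project `x.point` to `y.line`
  exact hrq (h.projection_unique h4 ⟨hx, hrx, hry⟩ ⟨hpl, hql, hy⟩).1

theorem incidences_of_mem_flagRel_seven {x y : GQFlag Inc} (hxy : (x, y) ∈ flagRel Inc 7) :
    (x.line ≠ y.line ∧ x.point ≠ y.point ∧ ¬ Inc y.point x.line ∧ ¬ Inc x.point y.line) ∧
      (¬ ∃ l, Inc x.point l ∧ Inc y.point l) ∧ ¬ ∃ r, Inc r x.line ∧ Inc r y.line := by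
  have hx := x.inc
  have hy := y.inc
  obtain ⟨hm, hc⟩ := mem_flagRel_seven.1 hxy
  have h3 : ¬ Inc y.point x.line := fun h' => hm ⟨_, h', hy⟩
  have h4 : ¬ Inc x.point y.line := fun h' => hm ⟨_, hx, h'⟩
  have hp : x.point ≠ y.point := fun e => h3 (e ▸ hx)
  exact ⟨⟨fun e => h3 (e ▸ hy), hp, h3, h4⟩, fun ⟨l, hl⟩ => hc ⟨l, hp, hl⟩, hm⟩

theorem flagRel_unique (h : IsGeneralizedQuadrangle Inc s t) {x y : GQFlag Inc} {i j : Fin 8}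
    (hi : (x, y) ∈ flagRel Inc i) (hj : (x, y) ∈ flagRel Inc j) : i = j := by
  have hx := x.inc
  have hy := y.inc
  have h0 := @mem_flagRel_zero P L Inc x y
  have h1 := @mem_flagRel_one P L Inc x y
  have h2 := @mem_flagRel_two P L Inc x y
  have h3 := @mem_flagRel_three P L Inc x y
  have h4 := @mem_flagRel_four P L Inc x y
  have h5 := @mem_flagRel_five P L Inc x y
  have h6 := @incidences_of_mem_flagRel_six P L Inc s t h x y
  have h7 := @incidences_of_mem_flagRel_seven P L Inc x y
  -- two distinct points are on at most one line, which separates `R_3` from `R_4`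
  have h34 := h.line_unique x.point y.point x.line y.line
  generalize (∃ l, Inc x.point l ∧ Inc y.point l) = c at *
  generalize (∃ r, Inc r x.line ∧ Inc r y.line) = m at *
  fin_cases i <;> fin_cases j <;> first
    | rfl
    | exfalso; simp only [Fin.reduceFinMk] at hi hj; grind

theorem IsGeneralizedQuadrangle.exists_line_ne (h : IsGeneralizedQuadrangle Inc s t) (ht : 1 ≤ t)
    (p : P) (l : L) : ∃ m, Inc p m ∧ m ≠ l := by
  have hc := h.card_lines p
  exact Set.exists_ne_of_one_lt_ncard (s := {l | Inc p l}) (by omega) l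

theorem IsGeneralizedQuadrangle.exists_point_ne (h : IsGeneralizedQuadrangle Inc s t) (hs : 1 ≤ s)
    (l : L) (p : P) : ∃ q, Inc q l ∧ q ≠ p := by
  have hc := h.card_points l
  exact Set.exists_ne_of_one_lt_ncard (s := {q | Inc q l}) (by omega) p

theorem exists_mem_flagRel_one (h : IsGeneralizedQuadrangle Inc s t) (ht : 1 ≤ t)
    (x : GQFlag Inc) : ∃ y, (x, y) ∈ flagRel Inc 1 := by
  obtain ⟨m, hm, hne⟩ := h.exists_line_ne ht x.point x.line
  exact ⟨.mk hm, rfl, hne.symm⟩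

theorem exists_mem_flagRel_two (h : IsGeneralizedQuadrangle Inc s t) (hs : 1 ≤ s)
    (x : GQFlag Inc) : ∃ y, (x, y) ∈ flagRel Inc 2 := by
  obtain ⟨q, hq, hne⟩ := h.exists_point_ne hs x.line x.point
  exact ⟨.mk hq, rfl, hne.symm⟩

theorem GQFlag.nonempty (h : IsGeneralizedQuadrangle Inc s t) : Nonempty (GQFlag Inc) := by
  obtain ⟨p⟩ := h.nonempty_points
  obtain ⟨l, hl⟩ := Set.nonempty_of_ncard_ne_zero (s := {l | Inc p l})
    (by rw [h.card_lines]; omega)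
  exact ⟨.mk hl⟩

/-! ### Factorization of the relations along shortest chains -/

theorem mem_flagRel_three_iff {x z : GQFlag Inc} : (x, z) ∈ flagRel Inc 3 ↔
    ∃ y, (x, y) ∈ flagRel Inc 2 ∧ (y, z) ∈ flagRel Inc 1 := by
  rw [mem_flagRel_three]
  constructor
  · rintro ⟨hp, hi, hl⟩
    exact ⟨.mk hi, ⟨rfl, hp⟩, rfl, hl⟩
  · rintro ⟨y, ⟨hl, hp⟩, hp', hl'⟩
    exact ⟨hp' ▸ hp, hp' ▸ hl ▸ y.inc, hl ▸ hl'⟩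

theorem mem_flagRel_four_iff {x z : GQFlag Inc} : (x, z) ∈ flagRel Inc 4 ↔
    ∃ y, (x, y) ∈ flagRel Inc 1 ∧ (y, z) ∈ flagRel Inc 2 := by
  rw [mem_flagRel_four]
  constructor
  · rintro ⟨hp, hi, hl⟩
    exact ⟨.mk hi, ⟨rfl, hl⟩, rfl, hp⟩
  · rintro ⟨y, ⟨hp, hl⟩, hl', hp'⟩
    exact ⟨hp ▸ hp', hp ▸ hl' ▸ y.inc, hl' ▸ hl⟩

theorem mem_flagRel_five_iff (h : IsGeneralizedQuadrangle Inc s t) {x z : GQFlag Inc} :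
    (x, z) ∈ flagRel Inc 5 ↔ ∃ y, (x, y) ∈ flagRel Inc 1 ∧ (y, z) ∈ flagRel Inc 3 := by
  simp only [mem_flagRel_five, mem_flagRel_one, mem_flagRel_three]
  constructor
  · rintro ⟨⟨l, hxl, hzl⟩, hp, h3, h4⟩
    refine ⟨.mk hxl, ⟨rfl, ?_⟩, hp, hzl, ?_⟩
    · rintro rfl
      exact h3 hzl
    · rintro rfl
      exact h4 hxl
  · rintro ⟨y, ⟨hp, hl⟩, hp', hi, hl'⟩
    have hy := y.inc
    rw [← hp] at hp' hy
    exact ⟨⟨y.line, hy, hi⟩, hp', fun h' => hl (h.line_unique _ _ _ _ hp' x.inc h' hy hi),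
      fun h' => hl' (h.line_unique _ _ _ _ hp' hy hi h' z.inc)⟩

theorem mem_flagRel_six_iff {x z : GQFlag Inc} :
    (x, z) ∈ flagRel Inc 6 ↔ ∃ y, (x, y) ∈ flagRel Inc 2 ∧ (y, z) ∈ flagRel Inc 4 := by
  simp only [mem_flagRel_six, mem_flagRel_two, mem_flagRel_four]
  constructor
  · rintro ⟨r, ⟨hl, hrx, hrz⟩, hp, hq⟩
    exact ⟨.mk hrx, ⟨rfl, hp.symm⟩, hq, hrz, hl⟩
  · rintro ⟨y, ⟨hl, hp⟩, hp', hi, hl'⟩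
    exact ⟨y.point, ⟨hl ▸ hl', hl ▸ y.inc, hi⟩, hp.symm, hp'⟩

theorem mem_flagRel_seven_iff_one_six (h : IsGeneralizedQuadrangle Inc s t) {x z : GQFlag Inc} :
    (x, z) ∈ flagRel Inc 7 ↔ ∃ y, (x, y) ∈ flagRel Inc 1 ∧ (y, z) ∈ flagRel Inc 6 := by
  constructor
  · intro hxz
    obtain ⟨⟨-, -, -, h4⟩, hc, hm⟩ := incidences_of_mem_flagRel_seven hxz
    -- the middle flag carries the line joining `x.point` to its projection on `z.line`
    obtain ⟨r, n, hxn, hrn, hrz⟩ := h.exists_projection h4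
    refine ⟨.mk hxn, mem_flagRel_one.2 ⟨rfl, (?_ : x.line ≠ n)⟩, mem_flagRel_six.2
      ⟨r, ⟨(?_ : n ≠ z.line), hrn, hrz⟩, (?_ : r ≠ x.point), ?_⟩⟩
    · rintro rfl
      exact hm ⟨r, hrn, hrz⟩
    · rintro rfl
      exact h4 hxn
    · rintro rfl
      exact h4 hrz
    · rintro rfl
      exact hc ⟨n, hxn, hrn⟩
  · rintro ⟨y, hxy, hyz⟩
    obtain ⟨hp, hl⟩ := mem_flagRel_one.1 hxy
    obtain ⟨⟨-, -, -, h4⟩, hc, r, hry, hrz⟩ := incidences_of_mem_flagRel_six h hyz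
    refine mem_flagRel_seven.2 ⟨?_, ?_⟩
    · rintro ⟨u, hux, huz⟩
      exact hl (h.projection_unique h4 ⟨hp ▸ x.inc, hux, huz⟩ ⟨y.inc, hry, hrz⟩).2
    · rintro ⟨l, -, hxl, hzl⟩
      exact hc ⟨l, hp ▸ hxl, hzl⟩

theorem mem_flagRel_seven_iff_two_five (h : IsGeneralizedQuadrangle Inc s t) {x z : GQFlag Inc} :
    (x, z) ∈ flagRel Inc 7 ↔ ∃ y, (x, y) ∈ flagRel Inc 2 ∧ (y, z) ∈ flagRel Inc 5 := by
  constructor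
  · intro hxz
    obtain ⟨⟨-, -, h3, -⟩, hc, hm⟩ := incidences_of_mem_flagRel_seven hxz
    -- the middle flag carries the projection of `z.point` on `x.line`
    obtain ⟨r, n, hzn, hrn, hrx⟩ := h.exists_projection h3
    refine ⟨.mk hrx, mem_flagRel_two.2 ⟨rfl, (?_ : x.point ≠ r)⟩, mem_flagRel_five.2
      ⟨⟨n, hrn, hzn⟩, (?_ : r ≠ z.point), h3, ?_⟩⟩
    · rintro rfl
      exact hc ⟨n, hrn, hzn⟩
    · rintro rfl
      exact h3 hrx
    · exact fun hrz => hm ⟨r, hrx, hrz⟩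
  · rintro ⟨y, hxy, hyz⟩
    obtain ⟨hl, hp⟩ := mem_flagRel_two.1 hxy
    obtain ⟨⟨n, hyn, hzn⟩, hp', h3, h4⟩ := mem_flagRel_five.1 hyz
    have hyx : Inc y.point x.line := hl ▸ y.inc
    rw [← hl] at h3
    refine mem_flagRel_seven.2 ⟨?_, ?_⟩
    · rintro ⟨u, hux, huz⟩
      exact h4 ((h.projection_unique h3 ⟨z.inc, huz, hux⟩ ⟨hzn, hyn, hyx⟩).1 ▸ huz)
    · rintro ⟨l, -, hxl, hzl⟩
      exact hp (h.projection_unique h3 ⟨hzl, hxl, x.inc⟩ ⟨hzn, hyn, hyx⟩).1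

theorem flagRel_nonempty (h : IsGeneralizedQuadrangle Inc s t) (hs : 1 ≤ s) (ht : 1 ≤ t)
    (i : Fin 8) : (flagRel Inc i).Nonempty := by
  have e1 := exists_mem_flagRel_one h ht
  have e2 := exists_mem_flagRel_two h hs
  have e3 : ∀ x, ∃ y, (x, y) ∈ flagRel Inc 3 := fun x =>
    let ⟨y, hy⟩ := e2 x
    let ⟨z, hz⟩ := e1 y
    ⟨z, mem_flagRel_three_iff.2 ⟨y, hy, hz⟩⟩
  have e4 : ∀ x, ∃ y, (x, y) ∈ flagRel Inc 4 := fun x =>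
    let ⟨y, hy⟩ := e1 x
    let ⟨z, hz⟩ := e2 y
    ⟨z, mem_flagRel_four_iff.2 ⟨y, hy, hz⟩⟩
  have e5 : ∀ x, ∃ y, (x, y) ∈ flagRel Inc 5 := fun x =>
    let ⟨y, hy⟩ := e1 x
    let ⟨z, hz⟩ := e3 y
    ⟨z, (mem_flagRel_five_iff h).2 ⟨y, hy, hz⟩⟩
  have e6 : ∀ x, ∃ y, (x, y) ∈ flagRel Inc 6 := fun x =>
    let ⟨y, hy⟩ := e2 x
    let ⟨z, hz⟩ := e4 y
    ⟨z, mem_flagRel_six_iff.2 ⟨y, hy, hz⟩⟩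
  have e7 : ∀ x, ∃ y, (x, y) ∈ flagRel Inc 7 := fun x =>
    let ⟨y, hy⟩ := e1 x
    let ⟨z, hz⟩ := e6 y
    ⟨z, (mem_flagRel_seven_iff_one_six h).2 ⟨y, hy, hz⟩⟩
  have e : ∀ x, ∃ y, (x, y) ∈ flagRel Inc i := by
    fin_cases i
    exacts [fun x => ⟨x, rfl⟩, e1, e2, e3, e4, e5, e6, e7]
  obtain ⟨x⟩ := GQFlag.nonempty h
  obtain ⟨y, hy⟩ := e x
  exact ⟨_, hy⟩

/-! ### Adjacency matrices -/

open Classical in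
variable (Inc) in
/-- The adjacency matrix of `R_i`, with integer entries. -/
noncomputable def flagAdj (i : Fin 8) : Matrix (GQFlag Inc) (GQFlag Inc) ℤ :=
  .of fun x y => if (x, y) ∈ flagRel Inc i then 1 else 0

theorem flagAdj_of_mem {i : Fin 8} {x y : GQFlag Inc} (h : (x, y) ∈ flagRel Inc i) :
    flagAdj Inc i x y = 1 := if_pos h

theorem flagAdj_of_notMem {i : Fin 8} {x y : GQFlag Inc} (h : (x, y) ∉ flagRel Inc i) :
    flagAdj Inc i x y = 0 := if_neg h

open Classical in
theorem flagAdj_zero : flagAdj Inc 0 = 1 := by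
  ext x y
  simp [flagAdj, mem_flagRel_zero, Matrix.one_apply]

theorem ncard_flagRel_one_one (x z : GQFlag Inc) (hp : x.point = z.point) :
    Set.ncard {y | (x, y) ∈ flagRel Inc 1 ∧ (y, z) ∈ flagRel Inc 1} =
      Set.ncard ({l | Inc x.point l} \ {x.line, z.line}) := by
  refine Set.ncard_congr (fun y _ => y.line) ?_ ?_ ?_
  · rintro y ⟨⟨h1, h2⟩, -, h3⟩
    exact ⟨h1 ▸ y.inc, by simp [h2.symm, h3]⟩
  · rintro y y' ⟨⟨h1, -⟩, -⟩ ⟨⟨h1', -⟩, -⟩ hl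
    exact GQFlag.ext (h1.symm.trans h1') hl
  · rintro l ⟨hl, hne⟩
    simp only [Set.mem_insert_iff, Set.mem_singleton_iff, not_or] at hne
    exact ⟨.mk hl, ⟨⟨rfl, Ne.symm hne.1⟩, hp, hne.2⟩, rfl⟩

theorem ncard_flagRel_two_two (x z : GQFlag Inc) (hl : x.line = z.line) :
    Set.ncard {y | (x, y) ∈ flagRel Inc 2 ∧ (y, z) ∈ flagRel Inc 2} =
      Set.ncard ({p | Inc p x.line} \ {x.point, z.point}) := by
  refine Set.ncard_congr (fun y _ => y.point) ?_ ?_ ?_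
  · rintro y ⟨⟨h1, h2⟩, -, h3⟩
    exact ⟨h1 ▸ y.inc, by simp [h2.symm, h3]⟩
  · rintro y y' ⟨⟨h1, -⟩, -⟩ ⟨⟨h1', -⟩, -⟩ hp
    exact GQFlag.ext hp (h1.symm.trans h1')
  · rintro p ⟨hp, hne⟩
    simp only [Set.mem_insert_iff, Set.mem_singleton_iff, not_or] at hne
    exact ⟨.mk hp, ⟨⟨rfl, Ne.symm hne.1⟩, hl, hne.2⟩, rfl⟩

section Products

variable [Fintype (GQFlag Inc)]

theorem flagAdj_mul_apply (i j : Fin 8) (x y : GQFlag Inc) :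
    (flagAdj Inc i * flagAdj Inc j) x y =
      Set.ncard {z | (x, z) ∈ flagRel Inc i ∧ (z, y) ∈ flagRel Inc j} := by
  classical
  rw [Matrix.mul_apply, Set.ncard_eq_toFinset_card']
  simp only [flagAdj, Matrix.of_apply, ← ite_and, ite_mul, one_mul, zero_mul]
  rw [Finset.sum_boole]
  congr 2
  ext
  simp

theorem flagAdj_mul_of_existsUnique {i j k : Fin 8}
    (hex : ∀ x z, (x, z) ∈ flagRel Inc k ↔ ∃ y, (x, y) ∈ flagRel Inc i ∧ (y, z) ∈ flagRel Inc j)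
    (huniq : ∀ x z y y', (x, y) ∈ flagRel Inc i → (y, z) ∈ flagRel Inc j →
      (x, y') ∈ flagRel Inc i → (y', z) ∈ flagRel Inc j → y = y') :
    flagAdj Inc i * flagAdj Inc j = flagAdj Inc k := by
  ext x z
  rw [flagAdj_mul_apply]
  by_cases hxz : (x, z) ∈ flagRel Inc k
  · obtain ⟨y, hy⟩ := (hex x z).1 hxz
    rw [flagAdj_of_mem hxz, Nat.cast_eq_one, Set.ncard_eq_one]
    refine ⟨y, Set.eq_singleton_iff_unique_mem.2 ⟨hy, fun y' hy' => ?_⟩⟩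
    exact huniq x z _ _ hy'.1 hy'.2 hy.1 hy.2
  · rw [flagAdj_of_notMem hxz, Nat.cast_eq_zero]
    convert Set.ncard_empty (GQFlag Inc)
    exact Set.eq_empty_iff_forall_notMem.2 fun y hy => hxz ((hex x z).2 ⟨y, hy⟩)

theorem flagAdj_two_mul_one : flagAdj Inc 2 * flagAdj Inc 1 = flagAdj Inc 3 :=
  flagAdj_mul_of_existsUnique (fun _ _ => mem_flagRel_three_iff)
    fun _ _ _ _ h1 h2 h1' h2' => GQFlag.ext (h2.1.trans h2'.1.symm) (h1.1.symm.trans h1'.1)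

theorem flagAdj_one_mul_two : flagAdj Inc 1 * flagAdj Inc 2 = flagAdj Inc 4 :=
  flagAdj_mul_of_existsUnique (fun _ _ => mem_flagRel_four_iff)
    fun _ _ _ _ h1 h2 h1' h2' => GQFlag.ext (h1.1.symm.trans h1'.1) (h2.1.trans h2'.1.symm)

theorem flagAdj_one_mul_three (h : IsGeneralizedQuadrangle Inc s t) :
    flagAdj Inc 1 * flagAdj Inc 3 = flagAdj Inc 5 := by
  refine flagAdj_mul_of_existsUnique (fun _ _ => mem_flagRel_five_iff h) ?_
  intro x z y y' h1 h2 h1' h2'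
  rw [mem_flagRel_three] at h2 h2'
  have hp := h1.1.symm.trans h1'.1
  exact GQFlag.ext hp (h.line_unique _ _ _ _ h2.1 y.inc h2.2.1 (hp ▸ y'.inc) h2'.2.1)

theorem flagAdj_two_mul_four (h : IsGeneralizedQuadrangle Inc s t) :
    flagAdj Inc 2 * flagAdj Inc 4 = flagAdj Inc 6 := by
  refine flagAdj_mul_of_existsUnique (fun _ _ => mem_flagRel_six_iff) ?_
  intro x z y y' h1 h2 h1' h2'
  rw [mem_flagRel_four] at h2 h2'
  have hl := h1.1.symm.trans h1'.1
  exact GQFlag.ext (h.point_unique _ _ _ _ h2.2.2 y.inc h2.2.1 (hl ▸ y'.inc) h2'.2.1) hl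

theorem flagAdj_one_mul_six (h : IsGeneralizedQuadrangle Inc s t) :
    flagAdj Inc 1 * flagAdj Inc 6 = flagAdj Inc 7 := by
  refine flagAdj_mul_of_existsUnique (fun _ _ => mem_flagRel_seven_iff_one_six h) ?_
  intro x z y y' h1 h2 h1' h2'
  have hp := h1.1.symm.trans h1'.1
  obtain ⟨⟨-, -, -, h4⟩, -, r, hry, hrz⟩ := incidences_of_mem_flagRel_six h h2
  obtain ⟨-, -, r', hry', hrz'⟩ := incidences_of_mem_flagRel_six h h2'
  exact GQFlag.ext hp
    (h.projection_unique h4 ⟨y.inc, hry, hrz⟩ ⟨hp ▸ y'.inc, hry', hrz'⟩).2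

theorem flagAdj_two_mul_five (h : IsGeneralizedQuadrangle Inc s t) :
    flagAdj Inc 2 * flagAdj Inc 5 = flagAdj Inc 7 := by
  refine flagAdj_mul_of_existsUnique (fun _ _ => mem_flagRel_seven_iff_two_five h) ?_
  intro x z y y' h1 h2 h1' h2'
  have hl := h1.1.symm.trans h1'.1
  obtain ⟨⟨n, hyn, hzn⟩, -, h3, -⟩ := mem_flagRel_five.1 h2
  obtain ⟨⟨n', hyn', hzn'⟩, -⟩ := mem_flagRel_five.1 h2'
  exact GQFlag.ext
    (h.projection_unique h3 ⟨hzn, hyn, y.inc⟩ ⟨hzn', hyn', hl ▸ y'.inc⟩).1 hl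

/-! ### The quadratic relations -/

theorem flagAdj_one_mul_one [Finite L] (h : IsGeneralizedQuadrangle Inc s t) :
    flagAdj Inc 1 * flagAdj Inc 1 = (t : ℤ) • flagAdj Inc 0 + ((t : ℤ) - 1) • flagAdj Inc 1 := by
  ext x z
  rw [flagAdj_mul_apply, Matrix.add_apply, Matrix.smul_apply, Matrix.smul_apply]
  by_cases hp : x.point = z.point
  · have hsub : {x.line, z.line} ⊆ {l | Inc x.point l} := by
      rintro l (rfl | rfl)
      exacts [x.inc, hp ▸ z.inc]
    have hcard := Set.ncard_sdiff_add_ncard_of_subset hsub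
    rw [h.card_lines, ← ncard_flagRel_one_one x z hp] at hcard
    by_cases hl : x.line = z.line
    · rw [flagAdj_of_mem (i := 0) (GQFlag.ext hp hl), flagAdj_of_notMem (i := 1) fun h' => h'.2 hl]
      rw [hl, Set.pair_eq_singleton, Set.ncard_singleton] at hcard
      simp only [smul_eq_mul]
      omega
    · rw [flagAdj_of_notMem (i := 0) fun h' => hl (congrArg GQFlag.line h'),
        flagAdj_of_mem (i := 1) ⟨hp, hl⟩]
      rw [Set.ncard_pair hl] at hcard
      simp only [smul_eq_mul]
      omega
  · rw [flagAdj_of_notMem (i := 0) fun h' => hp (congrArg GQFlag.point h'),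
      flagAdj_of_notMem (i := 1) fun h' => hp h'.1]
    convert (Int.natCast_eq_zero (n := 0)).2 rfl using 2
    · convert Set.ncard_empty (GQFlag Inc)
      exact Set.eq_empty_iff_forall_notMem.2 fun y hy => hp (hy.1.1.trans hy.2.1)
    · simp

theorem flagAdj_two_mul_two [Finite P] (h : IsGeneralizedQuadrangle Inc s t) :
    flagAdj Inc 2 * flagAdj Inc 2 = (s : ℤ) • flagAdj Inc 0 + ((s : ℤ) - 1) • flagAdj Inc 2 := by
  ext x z
  rw [flagAdj_mul_apply, Matrix.add_apply, Matrix.smul_apply, Matrix.smul_apply]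
  by_cases hl : x.line = z.line
  · have hsub : {x.point, z.point} ⊆ {p | Inc p x.line} := by
      rintro p (rfl | rfl)
      exacts [x.inc, hl ▸ z.inc]
    have hcard := Set.ncard_sdiff_add_ncard_of_subset hsub
    rw [h.card_points, ← ncard_flagRel_two_two x z hl] at hcard
    by_cases hp : x.point = z.point
    · rw [flagAdj_of_mem (i := 0) (GQFlag.ext hp hl), flagAdj_of_notMem (i := 2) fun h' => h'.2 hp]
      rw [hp, Set.pair_eq_singleton, Set.ncard_singleton] at hcard
      simp only [smul_eq_mul]
      omega
    · rw [flagAdj_of_notMem (i := 0) fun h' => hp (congrArg GQFlag.point h'),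
        flagAdj_of_mem (i := 2) ⟨hl, hp⟩]
      rw [Set.ncard_pair hp] at hcard
      simp only [smul_eq_mul]
      omega
  · rw [flagAdj_of_notMem (i := 0) fun h' => hl (congrArg GQFlag.line h'),
      flagAdj_of_notMem (i := 2) fun h' => hl h'.1]
    convert (Int.natCast_eq_zero (n := 0)).2 rfl using 2
    · convert Set.ncard_empty (GQFlag Inc)
      exact Set.eq_empty_iff_forall_notMem.2 fun y hy => hl (hy.1.1.trans hy.2.1)
    · simp

/-! ### The multiplication table -/

theorem flagAdj_zero_mul (j : Fin 8) :
    flagAdj Inc 0 * flagAdj Inc j =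
      ∑ k, flagMatrix (s : ℤ) (t : ℤ) k 0 j • flagAdj Inc k := by
  classical
  rw [flagAdj_zero, one_mul]
  fin_cases j <;> simp [Fin.sum_univ_eight, flagMatrix]

theorem flagAdj_one_mul [Finite L] (h : IsGeneralizedQuadrangle Inc s t) (j : Fin 8) :
    flagAdj Inc 1 * flagAdj Inc j =
      ∑ k, flagMatrix (s : ℤ) (t : ℤ) k 1 j • flagAdj Inc k := by
  classical
  have hsq := flagAdj_one_mul_one h
  have hstep : ∀ {i k}, flagAdj Inc 1 * flagAdj Inc i = flagAdj Inc k →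
      flagAdj Inc 1 * flagAdj Inc k = (t : ℤ) • flagAdj Inc i + ((t : ℤ) - 1) • flagAdj Inc k := by
    intro i k hik
    rw [← hik, ← mul_assoc, hsq, flagAdj_zero]
    simp only [add_mul, smul_mul_assoc, one_mul]
  have h0 : flagAdj Inc 1 * flagAdj Inc 0 = flagAdj Inc 1 := by rw [flagAdj_zero, mul_one]
  have h2 := flagAdj_one_mul_two (Inc := Inc)
  have h3 := flagAdj_one_mul_three h
  have h6 := flagAdj_one_mul_six h
  have h4 := hstep h2
  have h5 := hstep h3
  have h7 := hstep h6
  fin_cases j <;> simp [Fin.sum_univ_eight, flagMatrix, *]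

theorem flagAdj_two_mul [Finite P] (h : IsGeneralizedQuadrangle Inc s t) (j : Fin 8) :
    flagAdj Inc 2 * flagAdj Inc j =
      ∑ k, flagMatrix (s : ℤ) (t : ℤ) k 2 j • flagAdj Inc k := by
  classical
  have hsq := flagAdj_two_mul_two h
  have hstep : ∀ {i k}, flagAdj Inc 2 * flagAdj Inc i = flagAdj Inc k →
      flagAdj Inc 2 * flagAdj Inc k = (s : ℤ) • flagAdj Inc i + ((s : ℤ) - 1) • flagAdj Inc k := by
    intro i k hik
    rw [← hik, ← mul_assoc, hsq, flagAdj_zero]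
    simp only [add_mul, smul_mul_assoc, one_mul]
  have h0 : flagAdj Inc 2 * flagAdj Inc 0 = flagAdj Inc 2 := by rw [flagAdj_zero, mul_one]
  have h1 := flagAdj_two_mul_one (Inc := Inc)
  have h4 := flagAdj_two_mul_four h
  have h5 := flagAdj_two_mul_five h
  have h3 := hstep h1
  have h6 := hstep h4
  have h7 := hstep h5
  fin_cases j <;> simp [Fin.sum_univ_eight, flagMatrix, *]

/-- Left multiplication by a product is the composite of the left multiplications, so its
coefficient table is the product of the two tables. -/
theorem flagAdj_mul_of_factor {i j k : Fin 8} (hk : flagAdj Inc i * flagAdj Inc j = flagAdj Inc k)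
    (hi : ∀ n, flagAdj Inc i * flagAdj Inc n =
      ∑ m, flagMatrix (s : ℤ) (t : ℤ) m i n • flagAdj Inc m)
    (hj : ∀ n, flagAdj Inc j * flagAdj Inc n =
      ∑ m, flagMatrix (s : ℤ) (t : ℤ) m j n • flagAdj Inc m)
    (htable : ∀ n l, ∑ m, flagMatrix (s : ℤ) (t : ℤ) m j n * flagMatrix (s : ℤ) (t : ℤ) l i m =
      flagMatrix (s : ℤ) (t : ℤ) l k n) (n : Fin 8) :
    flagAdj Inc k * flagAdj Inc n =
      ∑ m, flagMatrix (s : ℤ) (t : ℤ) m k n • flagAdj Inc m := by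
  rw [← hk, mul_assoc, hj, Finset.mul_sum]
  simp only [mul_smul_comm, hi, Finset.smul_sum, smul_smul]
  rw [Finset.sum_comm]
  simp only [← Finset.sum_smul, htable]

theorem flagMatrix_mul_two_one (s t : ℤ) (n l : Fin 8) :
    ∑ m, flagMatrix s t m 1 n * flagMatrix s t l 2 m = flagMatrix s t l 3 n := by
  fin_cases n <;> fin_cases l <;> simp [Fin.sum_univ_eight, flagMatrix] <;> ring

theorem flagMatrix_mul_one_two (s t : ℤ) (n l : Fin 8) :
    ∑ m, flagMatrix s t m 2 n * flagMatrix s t l 1 m = flagMatrix s t l 4 n := by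
  fin_cases n <;> fin_cases l <;> simp [Fin.sum_univ_eight, flagMatrix]
  ring

theorem flagMatrix_mul_one_three (s t : ℤ) (n l : Fin 8) :
    ∑ m, flagMatrix s t m 3 n * flagMatrix s t l 1 m = flagMatrix s t l 5 n := by
  fin_cases n <;> fin_cases l <;> simp [Fin.sum_univ_eight, flagMatrix] <;> ring

theorem flagMatrix_mul_two_four (s t : ℤ) (n l : Fin 8) :
    ∑ m, flagMatrix s t m 4 n * flagMatrix s t l 2 m = flagMatrix s t l 6 n := by
  fin_cases n <;> fin_cases l <;> simp [Fin.sum_univ_eight, flagMatrix] <;> ring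

theorem flagMatrix_mul_one_six (s t : ℤ) (n l : Fin 8) :
    ∑ m, flagMatrix s t m 6 n * flagMatrix s t l 1 m = flagMatrix s t l 7 n := by
  fin_cases n <;> fin_cases l <;> simp [Fin.sum_univ_eight, flagMatrix] <;> ring

theorem flagAdj_mul [Finite P] [Finite L] (h : IsGeneralizedQuadrangle Inc s t) (i j : Fin 8) :
    flagAdj Inc i * flagAdj Inc j =
      ∑ k, flagMatrix (s : ℤ) (t : ℤ) k i j • flagAdj Inc k := by
  have h1 := flagAdj_one_mul h
  have h2 := flagAdj_two_mul h
  have h3 := flagAdj_mul_of_factor flagAdj_two_mul_one h2 h1 (flagMatrix_mul_two_one _ _)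
  have h4 := flagAdj_mul_of_factor flagAdj_one_mul_two h1 h2 (flagMatrix_mul_one_two _ _)
  have h5 := flagAdj_mul_of_factor (flagAdj_one_mul_three h) h1 h3 (flagMatrix_mul_one_three _ _)
  have h6 := flagAdj_mul_of_factor (flagAdj_two_mul_four h) h2 h4 (flagMatrix_mul_two_four _ _)
  have h7 := flagAdj_mul_of_factor (flagAdj_one_mul_six h) h1 h6 (flagMatrix_mul_one_six _ _)
  revert j
  fin_cases i
  exacts [flagAdj_zero_mul, h1, h2, h3, h4, h5, h6, h7]

end Products

/-! ### The association scheme -/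

theorem ncard_flagRel_flagRel [Finite P] [Finite L] (h : IsGeneralizedQuadrangle Inc s t)
    (i j k : Fin 8) (x y : GQFlag Inc) (hk : (x, y) ∈ flagRel Inc k) :
    (Set.ncard {z | (x, z) ∈ flagRel Inc i ∧ (z, y) ∈ flagRel Inc j} : ℤ) =
      flagMatrix (s : ℤ) (t : ℤ) k i j := by
  have := GQFlag.finite (Inc := Inc)
  have := Fintype.ofFinite (GQFlag Inc)
  rw [← flagAdj_mul_apply, flagAdj_mul h, Matrix.sum_apply, Finset.sum_eq_single k]
  · rw [Matrix.smul_apply, flagAdj_of_mem hk, smul_eq_mul, mul_one]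
  · intro l _ hl
    rw [Matrix.smul_apply, flagAdj_of_notMem fun h' => hl (flagRel_unique h h' hk), smul_zero]
  · simp

theorem card_flags [Finite P] [Finite L] (h : IsGeneralizedQuadrangle Inc s t) :
    Nat.card (GQFlag Inc) = (s + 1) * (t + 1) * (s * t + 1) := by
  have := GQFlag.finite (Inc := Inc)
  have := Fintype.ofFinite (GQFlag Inc)
  obtain ⟨x⟩ := GQFlag.nonempty h
  have hall : ∀ y z, (∑ i, flagAdj Inc i) y z = 1 := by
    intro y z
    obtain ⟨i, hi⟩ := exists_mem_flagRel y z
    rw [Matrix.sum_apply, Finset.sum_eq_single i, flagAdj_of_mem hi]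
    · intro l _ hl
      exact flagAdj_of_notMem fun h' => hl (flagRel_unique h h' hi)
    · simp
  have hcard : ((∑ i, flagAdj Inc i) * ∑ i, flagAdj Inc i) x x = Nat.card (GQFlag Inc) := by
    simp [Matrix.mul_apply, hall]
  have hsum : ((∑ i, flagAdj Inc i) * ∑ i, flagAdj Inc i) x x =
      ∑ i, ∑ j, flagMatrix (s : ℤ) (t : ℤ) 0 i j := by
    simp only [Finset.sum_mul_sum, Matrix.sum_apply, flagAdj_mul_apply,
      ncard_flagRel_flagRel h _ _ 0 x x rfl]
  zify
  rw [← hcard, hsum]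
  simp [Fin.sum_univ_eight, flagMatrix]
  ring

theorem flagRel_converse (i : Fin 8) :
    ∃ j, flagRel Inc j = {a | (a.2, a.1) ∈ flagRel Inc i} := by
  refine ⟨![0, 1, 2, 4, 3, 5, 6, 7] i, ?_⟩
  ext ⟨x, y⟩
  fin_cases i
  · exact eq_comm
  · exact and_congr eq_comm ne_comm
  · exact and_congr eq_comm ne_comm
  · exact mem_flagRel_four.trans (Iff.trans (by grind) mem_flagRel_three.symm)
  · exact mem_flagRel_three.trans (Iff.trans (by grind) mem_flagRel_four.symm)
  · exact mem_flagRel_five.trans (Iff.trans (by grind) mem_flagRel_five.symm)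
  · exact mem_flagRel_six.trans (Iff.trans (by grind) mem_flagRel_six.symm)
  · exact mem_flagRel_seven.trans (Iff.trans (by grind) mem_flagRel_seven.symm)

theorem flagMatrix_nonneg [Finite P] [Finite L] (h : IsGeneralizedQuadrangle Inc s t)
    (hs : 1 ≤ s) (ht : 1 ≤ t) (i j k : Fin 8) : 0 ≤ flagMatrix (s : ℤ) (t : ℤ) k i j := by
  obtain ⟨⟨x, y⟩, hxy⟩ := flagRel_nonempty h hs ht k
  rw [← ncard_flagRel_flagRel h i j k x y hxy]
  positivity

/-- The scheme of the flags of a generalized quadrangle. -/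
noncomputable def flagScheme [Finite P] [Finite L] (h : IsGeneralizedQuadrangle Inc s t)
    (hs : 1 ≤ s) (ht : 1 ≤ t) : AssociationScheme (GQFlag Inc) (Fin 8) where
  rel := flagRel Inc
  zero := 0
  -- the truncation is harmless by `flagMatrix_nonneg`
  p i j k := (flagMatrix (s : ℤ) (t : ℤ) k i j).toNat
  finite := GQFlag.finite
  rel_nonempty := flagRel_nonempty h hs ht
  partition a :=
    let ⟨i, hi⟩ := exists_mem_flagRel a.1 a.2
    ⟨i, hi, fun _ hj => flagRel_unique h hj hi⟩
  rel_zero := rfl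
  rel_symm := flagRel_converse
  card_eq i j k x y hxy := by
    rw [← ncard_flagRel_flagRel h i j k x y hxy, Int.toNat_natCast]

theorem not_isTrivialParabolic_union {X I : Type*} (S : AssociationScheme X I) {i j : I}
    (hi : i ≠ S.zero) (hj : j ≠ S.zero) (hij : i ≠ j) :
    ¬ S.IsTrivialParabolic (S.rel S.zero ∪ S.rel i) := by
  rintro (h | h)
  · obtain ⟨a, ha⟩ := S.rel_nonempty i
    exact hi ((S.partition a).unique ha (h ▸ Or.inr ha))
  · obtain ⟨a, ha⟩ := S.rel_nonempty j
    rcases (h ▸ Set.mem_univ a : a ∈ S.rel S.zero ∪ S.rel i) with h0 | h1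
    · exact hj ((S.partition a).unique ha h0)
    · exact hij ((S.partition a).unique h1 ha)

/-- The classes of `R_0 ∪ R_1` are the sets of flags with a common point. -/
theorem mem_flagRel_zero_union_one {x y : GQFlag Inc} :
    (x, y) ∈ flagRel Inc 0 ∪ flagRel Inc 1 ↔ x.point = y.point := by
  rw [Set.mem_union, mem_flagRel_zero, mem_flagRel_one]
  constructor
  · rintro (rfl | h)
    exacts [rfl, h.1]
  · intro hp
    by_cases hl : x.line = y.line
    exacts [Or.inl (GQFlag.ext hp hl), Or.inr ⟨hp, hl⟩]

/-- The classes of `R_0 ∪ R_2` are the sets of flags with a common line. -/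
theorem mem_flagRel_zero_union_two {x y : GQFlag Inc} :
    (x, y) ∈ flagRel Inc 0 ∪ flagRel Inc 2 ↔ x.line = y.line := by
  rw [Set.mem_union, mem_flagRel_zero, mem_flagRel_two]
  constructor
  · rintro (rfl | h)
    exacts [rfl, h.1]
  · intro hl
    by_cases hp : x.point = y.point
    exacts [Or.inl (GQFlag.ext hp hl), Or.inr ⟨hl, hp⟩]

end FlagScheme

theorem mainTheorem1 {P L : Type*} [Finite P] [Finite L] (Inc : P → L → Prop) (s t : ℕ)
    (hs : 1 ≤ s) (ht : 1 ≤ t) (hGQ : IsGeneralizedQuadrangle Inc s t) :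
    ∃ S : AssociationScheme (GQFlag Inc) (Fin 8),
      S.rel = flagRel Inc ∧ S.zero = 0 ∧
      S.order = (s + 1) * (t + 1) * (s * t + 1) ∧
      S.classNumber = 7 ∧
      ¬ S.IsCommutative ∧
      S.IsImprimitive ∧
      (S.IsParabolic (S.rel 0 ∪ S.rel 1) ∧ ¬ S.IsTrivialParabolic (S.rel 0 ∪ S.rel 1)) ∧
      (S.IsParabolic (S.rel 0 ∪ S.rel 2) ∧ ¬ S.IsTrivialParabolic (S.rel 0 ∪ S.rel 2)) ∧
      ∀ i j k, (S.p i j k : ℤ) = flagMatrix (s : ℤ) (t : ℤ) k i j := by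
  set S := flagScheme hGQ hs ht with hS
  have hpar1 : S.IsParabolic (S.rel 0 ∪ S.rel 1) := by
    refine ⟨⟨{0, 1}, by simp⟩, ?_⟩
    have he : (fun x y => (x, y) ∈ S.rel 0 ∪ S.rel 1) = fun x y => x.point = y.point :=
      funext₂ fun _ _ => propext mem_flagRel_zero_union_one
    rw [he]
    exact ⟨fun _ => rfl, Eq.symm, Eq.trans⟩
  have hpar2 : S.IsParabolic (S.rel 0 ∪ S.rel 2) := by
    refine ⟨⟨{0, 2}, by simp⟩, ?_⟩
    have he : (fun x y => (x, y) ∈ S.rel 0 ∪ S.rel 2) = fun x y => x.line = y.line :=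
      funext₂ fun _ _ => propext mem_flagRel_zero_union_two
    rw [he]
    exact ⟨fun _ => rfl, Eq.symm, Eq.trans⟩
  have hnt1 : ¬ S.IsTrivialParabolic (S.rel 0 ∪ S.rel 1) :=
    not_isTrivialParabolic_union S (i := (1 : Fin 8)) (j := (2 : Fin 8))
      (show (1 : Fin 8) ≠ 0 by decide) (show (2 : Fin 8) ≠ 0 by decide) (by decide)
  have hnt2 : ¬ S.IsTrivialParabolic (S.rel 0 ∪ S.rel 2) :=
    not_isTrivialParabolic_union S (i := (2 : Fin 8)) (j := (1 : Fin 8))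
      (show (2 : Fin 8) ≠ 0 by decide) (show (1 : Fin 8) ≠ 0 by decide) (by decide)
  refine ⟨S, rfl, rfl, card_flags hGQ, ?_, ?_, fun hprim => hnt1 (hprim _ hpar1),
    ⟨hpar1, hnt1⟩, ⟨hpar2, hnt2⟩, fun i j k =>
      Int.toNat_of_nonneg (flagMatrix_nonneg hGQ hs ht i j k)⟩
  · change Nat.card {i : Fin 8 // i ≠ 0} = 7
    rw [Nat.card_eq_fintype_card]
    decide
  · -- `R_1 R_2 = R_4`, while `R_2 R_1 = R_3`
    intro hcomm
    have h14 := hcomm 1 2 4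
    simp [hS, flagScheme, flagMatrix] at h14
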